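/- For positive integers $k,n$ let $$F_k(n)=\max_{\substack{A\subset\{-n,\ldots,n\}\\ |A|=k}}\#\bigl\{x\in\{-n,\ldots,n\} : a+x \text{ is a perfect square for every } a\in A\bigr\},$$ where $A$ ranges over the $k$-element sets of integers in $\{-n,\ldots,n\}$, $x$ is an integer, and the perfect squares are the integers $z^2$ with $z\in\mathbb Z$ (the maximum is read as $0$ if there is no such $A$). Theorem. $F_3(n)=\Omega\bigl((\log n)^{5/7}\bigr)$ as $n\to\infty$; that is, there are a constant $c>0$ and an integer $n_0$ such that $F_3(n)\ge c\,(\log n)^{5/7}$ for all integers $n\ge n_0$. -/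

import Mathlib

/-- The number of integers `x ∈ {-n, …, n}` such that the translate `A + x` consists of perfect
squares (`0` included). -/
noncomputable def squareTranslates (n : ℕ) (A : Finset ℤ) : ℕ :=
  ((Finset.Icc (-(n : ℤ)) (n : ℤ)).filter (fun x => ∀ a ∈ A, IsSquare (a + x))).card

/-- `F_k(n)`: the maximum of `squareTranslates n A` over all `k`-element sets
`A ⊆ {-n, …, n}`; it is `0` when there is no such set, that is, when `2 n + 1 < k`. -/
noncomputable def maxSquareTranslates (k n : ℕ) : ℕ :=
  ((Finset.Icc (-(n : ℤ)) (n : ℤ)).powersetCard k).sup (squareTranslates n)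

/-! On E : y² = x(x + 3654)(x + 4711), doubling a point makes x, x + 3654 and x + 4711 all rational
squares (`isSquare_X_sub_of_add_self`). The curve has five independent points
(`eq_zero_of_sum_zsmul_eq_zero`), and the height of a sum grows at most quadratically in its
coefficients (`exists_naiveHeight_sum_nsmul_le`). Doubling the combinations with coefficients in 1,
…, M therefore gives M⁵ distinct abscissas of logarithmic height O(M²)
(`exists_finset_isSquare_sub`).

Let D be the product of their denominators, so log D = O(M⁵ · M²). Multiplication by D² preserves
squares and makes every abscissa r an integer D²r, all sharing the set A = D²{0, 3654, 4711}
(`card_le_maxSquareTranslates`). Hence n = exp(O(M⁷)) already admits M⁵ translates, which gives the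
exponent 5/7. -/

section

open WeierstrassCurve WeierstrassCurve.Affine Height MvPolynomial

/-! ### The quadratic map from {x(P), x(Q)} to {x(P + Q), x(P - Q)}. -/

namespace WeierstrassCurve.Affine.Point

variable {F : Type*} [Field F] [DecidableEq F] {W : Affine F}

omit [DecidableEq F] in
lemma eval_addSubMap (x : Fin 3 → F) :
    (fun i ↦ (addSubMap W i).eval x) =
      ![x 0 ^ 2 - W.b₄ * x 0 * x 2 - W.b₆ * x 1 * x 2 - W.b₈ * x 2 ^ 2,
        2 * x 1 * x 0 + W.b₂ * x 0 * x 2 + W.b₄ * x 1 * x 2 + W.b₆ * x 2 ^ 2,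
        x 1 ^ 2 - 4 * x 0 * x 2] := by
  ext i
  fin_cases i <;> simp [addSubMap]

/-- The diagonal case is separate because the chord degenerates to a tangent there. -/
lemma sym2x_add_self_sub_self [W.IsElliptic] (P : W.Point) :
    ∃ c : F, c ≠ 0 ∧
      (fun i ↦ (addSubMap W i).eval (P.sym2x P)) = c • (P + P).sym2x (P - P) := by
  match P with
  | 0 => exact ⟨1, one_ne_zero, by rw [eval_addSubMap]; ext i; fin_cases i <;> simp⟩
  | some x y h =>
    have heq := (W.equation_iff x y).mp h.1
    by_cases hy : y = W.negY x y
    · have hne := addSubMap_ne_zero W (sym2x_ne_zero (some x y h) (some x y h))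
      rw [eval_addSubMap] at hne ⊢
      rw [add_self_of_Y_eq hy, sub_self, sym2x_zero_zero]
      rw [negY] at hy
      -- At a 2-torsion point the last two coordinates vanish: the 2-division polynomial and the
      -- discriminant of (T - x)². The first is then nonzero, since the map has no projective zero
      -- on an elliptic curve.
      have h1 : 2 * (x + x) * (x * x) + W.b₂ * (x * x) + W.b₄ * (x + x) + W.b₆ = 0 := by
        simp only [b₂, b₄, b₆]
        linear_combination (-4) * heq + (2 * y + W.a₁ * x + W.a₃) * hy
      have h2 : (x + x) ^ 2 - 4 * (x * x) = 0 := by ring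
      simp only [sym2x_some_some, Matrix.cons_val, mul_one, one_pow, h1, h2] at hne ⊢
      refine ⟨(x * x) ^ 2 - W.b₄ * (x * x) - W.b₆ * (x + x) - W.b₈, fun h0 ↦ hne ?_, ?_⟩
      · rw [h0]; ext i; fin_cases i <;> simp
      · ext i; fin_cases i <;> simp
    · rw [add_self_of_Y_ne hy, sub_self, eval_addSubMap]
      refine ⟨(y - W.negY x y) ^ 2, pow_ne_zero _ (sub_ne_zero.mpr hy), ?_⟩
      have hd := sub_ne_zero.mpr hy
      simp only [sym2x_some_some, sym2x_some_zero, slope_of_Y_ne rfl hy, addX, Matrix.cons_val]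
      set ℓ := (3 * x ^ 2 + 2 * W.a₂ * x + W.a₄ - W.a₁ * y) / (y - W.negY x y) with hℓ
      have hl : ℓ * (y - W.negY x y) = 3 * x ^ 2 + 2 * W.a₂ * x + W.a₄ - W.a₁ * y := by
        rw [hℓ]; field_simp
      clear_value ℓ
      ext i
      fin_cases i <;> simp only [b₂, b₄, b₆, b₈, negY] at hl ⊢ <;> simp
      · linear_combination
          -(ℓ * (y - (-y - W.a₁ * x - W.a₃)) + (3 * x ^ 2 + 2 * W.a₂ * x + W.a₄ - W.a₁ * y)
            + W.a₁ * (y - (-y - W.a₁ * x - W.a₃))) * hl + (W.a₁ ^ 2 + 4 * W.a₂ + 8 * x) * heq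
      · linear_combination (-4) * heq
      · ring

/-- The chord formulas give the generic case with factor (x₁ - x₂)². If x₁ = x₂ then P = ±Q, which
reduces to the diagonal. -/
lemma sym2x_add_sub [W.IsElliptic] (P Q : W.Point) :
    ∃ c : F, c ≠ 0 ∧
      (fun i ↦ (addSubMap W i).eval (P.sym2x Q)) = c • (P + Q).sym2x (P - Q) := by
  match P, Q with
  | 0, 0 => exact sym2x_add_self_sub_self 0
  | 0, some x y h =>
    refine ⟨1, one_ne_zero, ?_⟩
    rw [eval_addSubMap, zero_add, zero_sub, sym2x_neg_right]
    ext i; fin_cases i <;> simp <;> ring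
  | some x y h, 0 =>
    refine ⟨1, one_ne_zero, ?_⟩
    rw [eval_addSubMap, add_zero, sub_zero]
    ext i; fin_cases i <;> simp <;> ring
  | some x₁ y₁ h₁, some x₂ y₂ h₂ =>
    by_cases hx : x₁ = x₂
    · rcases X_eq_iff.mp hx with h | h
      · rw [h]; exact sym2x_add_self_sub_self _
      · rw [h, sym2x_neg_left, neg_add_cancel, ← neg_add', sym2x_neg_right, sym2x_comm 0]
        simpa only [sub_self] using sym2x_add_self_sub_self (some x₂ y₂ h₂)
    · have hd := sub_ne_zero.mpr hx
      have e₁ := (W.equation_iff x₁ y₁).mp h₁.1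
      have e₂ := (W.equation_iff x₂ y₂).mp h₂.1
      refine ⟨(x₁ - x₂) ^ 2, pow_ne_zero _ hd, ?_⟩
      rw [sub_eq_add_neg (some x₁ y₁ h₁), neg_some, add_of_X_ne hx, add_of_X_ne hx, eval_addSubMap]
      simp only [sym2x_some_some, slope_of_X_ne hx, addX, Matrix.cons_val]
      ext i
      fin_cases i <;> simp [b₂, b₄, b₆, b₈, negY]
      · field_simp
        grind
      · field_simp
        grind
      · ring

end WeierstrassCurve.Affine.Point

end

/-! ### Naive heights: half of the approximate parallelogram law, and quadratic growth. -/

section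

open WeierstrassCurve WeierstrassCurve.Affine Height

namespace WeierstrassCurve.Affine.Point

variable {K : Type*} [Field K] [AdmissibleAbsValues K] {W : Affine K}

/-- The naive logarithmic height of a point, that is, the height of its `x`-coordinate. -/
noncomputable def naiveHeight (P : W.Point) : ℝ := logHeight P.xRep

lemma naiveHeight_nonneg (P : W.Point) : 0 ≤ P.naiveHeight := logHeight_nonneg _

lemma naiveHeight_zero : (0 : W.Point).naiveHeight = 0 := by
  rw [naiveHeight, xRep_zero, logHeight_swap, ← logHeight₁_zero (K := K), logHeight₁_eq_logHeight]

lemma naiveHeight_some {x y : K} (h : W.Nonsingular x y) :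
    (some x y h).naiveHeight = logHeight₁ x := by
  rw [naiveHeight, xRep_some, logHeight₁_eq_logHeight]

variable [DecidableEq K]

/-- The height of the symmetric pair is the sum of the two heights up to O(1), and the addition map,
being a degree 2 morphism, doubles heights up to O(1). -/
lemma exists_naiveHeight_add_add_naiveHeight_sub_le [W.IsElliptic] :
    ∃ C, ∀ P Q : W.Point, (P + Q).naiveHeight + (P - Q).naiveHeight ≤
      2 * P.naiveHeight + 2 * Q.naiveHeight + C := by
  obtain ⟨C₁, h₁⟩ := logHeight_sym2_le K
  obtain ⟨C₂, h₂⟩ := logHeight_sym2_ge K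
  obtain ⟨C₃, h₃⟩ := W.abs_logHeight_addSubMap_sub_two_mul_logHeight_le
  refine ⟨2 * C₁ - C₂ + C₃, fun P Q ↦ ?_⟩
  have eta (P : W.Point) : ![P.xRep 0, P.xRep 1] = P.xRep := by
    ext i; fin_cases i <;> rfl
  have hge := h₂ (eta (P + Q) ▸ xRep_ne_zero _) (eta (P - Q) ▸ xRep_ne_zero _)
  have hle := h₁ (P.xRep 0) (P.xRep 1) (Q.xRep 0) (Q.xRep 1)
  rw [eta, eta] at hge hle
  obtain ⟨c, hc, h⟩ := sym2x_add_sub P Q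
  have hmap := (abs_sub_le_iff.mp (h₃ (P.sym2x Q))).1
  rw [h, logHeight_smul_eq_logHeight _ hc] at hmap
  simp only [sym2x] at hmap
  simp only [naiveHeight]
  linarith

/-- The second differences of n ↦ h(nP) are bounded above, so the first differences grow at most
linearly and the heights at most quadratically. No canonical height is needed. -/
lemma exists_naiveHeight_nsmul_le [W.IsElliptic] (P : W.Point) :
    ∃ C, 0 ≤ C ∧ ∀ n : ℕ, (n • P).naiveHeight ≤ C * n ^ 2 := by
  obtain ⟨C, hC⟩ := exists_naiveHeight_add_add_naiveHeight_sub_le (W := W)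
  set B := 2 * P.naiveHeight + |C| with hB
  have hB0 : 0 ≤ B := by have := P.naiveHeight_nonneg; positivity
  have hBP : P.naiveHeight ≤ B := by linarith [abs_nonneg C, P.naiveHeight_nonneg]
  have step (n : ℕ) : ((n + 2) • P).naiveHeight + (n • P).naiveHeight ≤
      2 * ((n + 1) • P).naiveHeight + B := by
    have := hC ((n + 1) • P) P
    rw [← succ_nsmul, show (n + 1) • P - P = n • P by rw [succ_nsmul]; abel] at this
    linarith [le_abs_self C]
  have diff (n : ℕ) : ((n + 1) • P).naiveHeight - (n • P).naiveHeight ≤ B * (n + 1) := by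
    induction n with
    | zero => simpa [naiveHeight_zero] using hBP
    | succ n ih => push_cast; linarith [step n]
  refine ⟨B, hB0, fun n ↦ ?_⟩
  induction n with
  | zero => simp [naiveHeight_zero]
  | succ n ih => push_cast; nlinarith [diff n, mul_nonneg hB0 n.cast_nonneg (α := ℝ)]

/-- Each addition costs a bounded factor, because h(P - Q) ≥ 0 can be dropped from the parallelogram
inequality. -/
lemma exists_naiveHeight_sum_le [W.IsElliptic] {ι : Type*} (s : Finset ι) :
    ∃ C, 0 ≤ C ∧ ∀ P : ι → W.Point,
      (∑ i ∈ s, P i).naiveHeight ≤ C * (1 + ∑ i ∈ s, (P i).naiveHeight) := by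
  classical
  obtain ⟨C₀, hC₀⟩ := exists_naiveHeight_add_add_naiveHeight_sub_le (W := W)
  induction s using Finset.induction_on with
  | empty => exact ⟨0, le_rfl, by simp [naiveHeight_zero]⟩
  | insert a s ha ih =>
    obtain ⟨C, hC, h⟩ := ih
    refine ⟨2 + 2 * C + |C₀|, by positivity, fun P ↦ ?_⟩
    rw [Finset.sum_insert ha, Finset.sum_insert ha]
    have h1 := hC₀ (P a) (∑ i ∈ s, P i)
    have h2 := naiveHeight_nonneg (P a - ∑ i ∈ s, P i)
    have h3 := h P
    have h4 : 0 ≤ ∑ i ∈ s, (P i).naiveHeight := Finset.sum_nonneg fun i _ ↦ naiveHeight_nonneg _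
    have h5 := naiveHeight_nonneg (P a)
    have h6 := abs_nonneg C₀
    nlinarith [le_abs_self C₀, mul_nonneg hC h5, mul_nonneg h6 h4, mul_nonneg h6 h5]

lemma exists_naiveHeight_sum_nsmul_le [W.IsElliptic] {ι : Type*} [Fintype ι] (P : ι → W.Point) :
    ∃ C, 0 ≤ C ∧ ∀ (M : ℕ) (m : ι → ℕ), 1 ≤ M → (∀ i, m i ≤ M) →
      (∑ i, m i • P i).naiveHeight ≤ C * M ^ 2 := by
  obtain ⟨C, hC, h⟩ := exists_naiveHeight_sum_le (W := W) (Finset.univ : Finset ι)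
  choose D hD hP using fun i ↦ exists_naiveHeight_nsmul_le (P i)
  have hsum : 0 ≤ ∑ i, D i := Finset.sum_nonneg fun i _ ↦ hD i
  refine ⟨C * (1 + ∑ i, D i), by positivity, fun M m hM hm ↦ ?_⟩
  have hM' : (1 : ℝ) ≤ (M : ℝ) ^ 2 := one_le_pow₀ (by exact_mod_cast hM)
  refine (h _).trans ?_
  rw [mul_assoc, add_mul, one_mul, Finset.sum_mul]
  gcongr with i
  refine (hP i _).trans ?_
  have := hD i
  gcongr
  exact hm i

end WeierstrassCurve.Affine.Point

end

/-! ### Doubling and 2-descent on curves with full rational 2-torsion. -/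

section

open WeierstrassCurve WeierstrassCurve.Affine

namespace WeierstrassCurve.Affine

/-- `W` is the curve `y² = (x - e₁) (x - e₂) (x - e₃)` with `e₁`, `e₂`, `e₃` distinct. -/
structure IsSplit {F : Type*} [Field F] (W : Affine F) (e₁ e₂ e₃ : F) : Prop where
  a₁ : W.a₁ = 0
  a₂ : W.a₂ = -(e₁ + e₂ + e₃)
  a₃ : W.a₃ = 0
  a₄ : W.a₄ = e₁ * e₂ + e₁ * e₃ + e₂ * e₃
  a₆ : W.a₆ = -(e₁ * e₂ * e₃)
  ne₁₂ : e₁ ≠ e₂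
  ne₁₃ : e₁ ≠ e₃
  ne₂₃ : e₂ ≠ e₃

namespace IsSplit

variable {F : Type*} [Field F] {W : Affine F} {e₁ e₂ e₃ : F} (hW : W.IsSplit e₁ e₂ e₃)

include hW

lemma rotate : W.IsSplit e₂ e₃ e₁ where
  a₁ := hW.a₁
  a₂ := by rw [hW.a₂]; ring
  a₃ := hW.a₃
  a₄ := by rw [hW.a₄]; ring
  a₆ := by rw [hW.a₆]; ring
  ne₁₂ := hW.ne₂₃
  ne₁₃ := hW.ne₁₂.symm
  ne₂₃ := hW.ne₁₃.symm

lemma equation_iff (x y : F) :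
    W.Equation x y ↔ y ^ 2 = (x - e₁) * (x - e₂) * (x - e₃) := by
  rw [W.equation_iff, hW.a₁, hW.a₂, hW.a₃, hW.a₄, hW.a₆]
  constructor <;> intro h <;> linear_combination h

lemma negY_eq (x y : F) : W.negY x y = -y := by
  simp [negY, hW.a₁, hW.a₃]

lemma nonsingular_of_ne [NeZero (2 : F)] {x y : F} (h : y ^ 2 = (x - e₁) * (x - e₂) * (x - e₃))
    (hy : y ≠ 0) : W.Nonsingular x y := by
  rw [nonsingular_iff', hW.equation_iff, hW.a₁, hW.a₃]
  exact ⟨h, .inr (by rw [zero_mul, add_zero, add_zero]; exact mul_ne_zero two_ne_zero hy)⟩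

lemma nonsingular_root : W.Nonsingular e₁ 0 := by
  rw [nonsingular_iff', hW.equation_iff, hW.a₁, hW.a₂, hW.a₄]
  refine ⟨by ring, .inl ?_⟩
  have := mul_ne_zero (sub_ne_zero.mpr hW.ne₁₂) (sub_ne_zero.mpr hW.ne₁₃)
  contrapose! this
  linear_combination -this

variable [DecidableEq F]

/-- The cubic minus the square of the line through the two points has roots x₁, x₂, x₃. At the root
e₁ the cubic vanishes and only the square of the line remains. -/
lemma addX_sub_mul {x₁ x₂ y₁ y₂ : F} (h₁ : W.Equation x₁ y₁) (h₂ : W.Equation x₂ y₂)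
    (hxy : ¬(x₁ = x₂ ∧ y₁ = W.negY x₂ y₂)) :
    (W.addX x₁ x₂ (W.slope x₁ x₂ y₁ y₂) - e₁) * (x₁ - e₁) * (x₂ - e₁) =
      (W.slope x₁ x₂ y₁ y₂ * (e₁ - x₁) + y₁) ^ 2 := by
  have h := congrArg (Polynomial.eval e₁) (addPolynomial_slope h₁ h₂ hxy)
  rw [addPolynomial_eq] at h
  simp only [Cubic.toPoly, hW.a₁, hW.a₂, hW.a₃, hW.a₄, hW.a₆, Polynomial.eval_neg,
    Polynomial.eval_add, Polynomial.eval_mul, Polynomial.eval_C, Polynomial.eval_pow,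
    Polynomial.eval_X, Polynomial.eval_sub] at h
  linear_combination -h

end IsSplit

namespace Point

variable {F : Type*} [Field F] [DecidableEq F] {W : Affine F}

/-- A representative of the image of a point under the `2`-descent map attached to the root `e₁`
of a split Weierstrass curve. -/
def descentValue (e₁ e₂ e₃ : F) : W.Point → F
  | 0 => 1
  | some x _ _ => if x = e₁ then (e₁ - e₂) * (e₁ - e₃) else x - e₁

variable {e₁ e₂ e₃ : F}

@[simp]
lemma descentValue_zero : (0 : W.Point).descentValue e₁ e₂ e₃ = 1 := rfl

lemma descentValue_some {x y : F} (h : W.Nonsingular x y) :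
    (some x y h).descentValue e₁ e₂ e₃ = if x = e₁ then (e₁ - e₂) * (e₁ - e₃) else x - e₁ := rfl

@[simp]
lemma descentValue_neg (P : W.Point) :
    (-P).descentValue e₁ e₂ e₃ = P.descentValue e₁ e₂ e₃ := by
  cases P <;> rfl

variable (hW : W.IsSplit e₁ e₂ e₃)

include hW

lemma descentValue_ne_zero (P : W.Point) : P.descentValue e₁ e₂ e₃ ≠ 0 := by
  match P with
  | 0 => exact one_ne_zero
  | some x y h =>
    rw [descentValue_some]
    split_ifs with hx
    · exact mul_ne_zero (sub_ne_zero.mpr hW.ne₁₂) (sub_ne_zero.mpr hW.ne₁₃)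
    · exact sub_ne_zero.mpr hx

/-- With T = (e₁, 0), translation satisfies (x(T + Q) - e₁)(x(Q) - e₁) = (e₁ - e₂)(e₁ - e₃), which
is the value assigned to T. -/
lemma isSquare_descentValue_root_add (Q : W.Point) :
    IsSquare ((some e₁ 0 hW.nonsingular_root + Q).descentValue e₁ e₂ e₃ *
      (some e₁ 0 hW.nonsingular_root).descentValue e₁ e₂ e₃ * Q.descentValue e₁ e₂ e₃) := by
  match Q with
  | 0 => exact ⟨(some e₁ 0 hW.nonsingular_root).descentValue e₁ e₂ e₃, by simp⟩
  | some x y h =>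
    have heq := (hW.equation_iff x y).mp h.1
    by_cases hx : e₁ = x
    · subst hx
      have hy : y = 0 := by simpa using heq
      subst hy
      rw [add_of_Y_eq rfl (by rw [hW.negY_eq]; simp)]
      exact ⟨(some e₁ 0 hW.nonsingular_root).descentValue e₁ e₂ e₃, by simp⟩
    · have hd : x - e₁ ≠ 0 := sub_ne_zero.mpr (Ne.symm hx)
      have hd' : e₁ - x ≠ 0 := sub_ne_zero.mpr hx
      have hX : (W.addX e₁ x (W.slope e₁ x 0 y) - e₁) * (x - e₁) = (e₁ - e₂) * (e₁ - e₃) := by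
        rw [slope_of_X_ne hx, addX, hW.a₁, hW.a₂]
        field_simp
        linear_combination (x - e₁) * heq
      have h0 := mul_ne_zero (sub_ne_zero.mpr hW.ne₁₂) (sub_ne_zero.mpr hW.ne₁₃)
      have hX0 : W.addX e₁ x (W.slope e₁ x 0 y) ≠ e₁ := by
        intro h; rw [h, sub_self, zero_mul] at hX; exact h0 hX.symm
      rw [add_of_X_ne hx, descentValue_some, descentValue_some, descentValue_some, if_neg hX0,
        if_pos rfl, if_neg (Ne.symm hx)]
      exact ⟨(e₁ - e₂) * (e₁ - e₃), by linear_combination (e₁ - e₂) * (e₁ - e₃) * hX⟩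

omit [DecidableEq F] in
lemma eq_root_of_X_eq {x y : F} (h : W.Nonsingular x y) (hx : x = e₁) :
    some x y h = some e₁ 0 hW.nonsingular_root := by
  subst hx
  have hy : y = 0 := by simpa using (hW.equation_iff x y).mp h.1
  subst hy
  rfl

/-- Multiplicativity modulo squares; this makes the parity of a p-adic valuation a homomorphism. -/
lemma isSquare_descentValue_add (P Q : W.Point) :
    IsSquare ((P + Q).descentValue e₁ e₂ e₃ * P.descentValue e₁ e₂ e₃ *
      Q.descentValue e₁ e₂ e₃) := by
  match P, Q with
  | 0, Q => exact ⟨Q.descentValue e₁ e₂ e₃, by simp⟩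
  | P, 0 => exact ⟨P.descentValue e₁ e₂ e₃, by simp⟩
  | some x₁ y₁ h₁, some x₂ y₂ h₂ =>
    by_cases hx₁ : x₁ = e₁
    · rw [eq_root_of_X_eq hW h₁ hx₁]
      exact isSquare_descentValue_root_add hW _
    by_cases hx₂ : x₂ = e₁
    · rw [eq_root_of_X_eq hW h₂ hx₂, add_comm, mul_right_comm]
      exact isSquare_descentValue_root_add hW _
    by_cases hxy : x₁ = x₂ ∧ y₁ = W.negY x₂ y₂
    · rw [add_of_Y_eq hxy.1 hxy.2, descentValue_some, descentValue_some, hxy.1]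
      exact ⟨if x₂ = e₁ then (e₁ - e₂) * (e₁ - e₃) else x₂ - e₁, by simp⟩
    · rw [add_some hxy]
      by_cases hX : W.addX x₁ x₂ (W.slope x₁ x₂ y₁ y₂) = e₁
      -- Here P + Q is the root point T, so Q = T + (-P) and the translation case applies to -P.
      · have hsum := add_some hxy (h₁ := h₁) (h₂ := h₂)
        rw [eq_root_of_X_eq hW _ hX] at hsum ⊢
        have := isSquare_descentValue_root_add hW (-some x₁ y₁ h₁)
        rw [← hsum, add_neg_cancel_comm, hsum, descentValue_neg] at this
        convert this using 1
        ring
      · rw [descentValue_some, descentValue_some, descentValue_some, if_neg hX, if_neg hx₁,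
          if_neg hx₂, hW.addX_sub_mul h₁.1 h₂.1 hxy]
        exact IsSquare.sq _

lemma eq_zero_or_eq_root_of_add_self_eq_zero [NeZero (2 : F)] {P : W.Point} (hP : P + P = 0) :
    P = 0 ∨ P = some e₁ 0 hW.nonsingular_root ∨ P = some e₂ 0 hW.rotate.nonsingular_root ∨
      P = some e₃ 0 hW.rotate.rotate.nonsingular_root := by
  match P with
  | 0 => exact .inl rfl
  | some x y h =>
    have hy : y = W.negY x y := by
      by_contra hy
      rw [add_self_of_Y_ne hy] at hP
      exact some_ne_zero _ hP
    rw [hW.negY_eq, eq_neg_iff_add_eq_zero, ← two_mul, mul_eq_zero, or_iff_right two_ne_zero] at hy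
    have heq := (hW.equation_iff x y).mp h.1
    rw [hy, zero_pow two_ne_zero, zero_eq_mul, mul_eq_zero, sub_eq_zero, sub_eq_zero,
      sub_eq_zero] at heq
    rcases heq with (hx | hx) | hx
    · exact .inr (.inl (eq_root_of_X_eq hW h hx))
    · exact .inr (.inr (.inl (eq_root_of_X_eq hW.rotate h hx)))
    · exact .inr (.inr (.inr (eq_root_of_X_eq hW.rotate.rotate h hx)))

/-- The chord identity with equal points reads (X - e₁)(x - e₁)² = square. Rotating the roots
handles e₂ and e₃. -/
lemma isSquare_X_sub_of_add_self {P : W.Point} {X Y : F} {h : W.Nonsingular X Y}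
    (hP : P + P = some X Y h) : IsSquare (X - e₁) := by
  match P with
  | 0 => exact absurd hP.symm (by simp)
  | some x y h' =>
    by_cases hy : y = W.negY x y
    · rw [add_self_of_Y_eq hy] at hP
      exact absurd hP.symm (some_ne_zero h)
    · rw [add_self_of_Y_ne hy] at hP
      have hX := (some.inj hP).1
      have hsq := hW.addX_sub_mul h'.1 h'.1 (fun hxy ↦ hy hxy.2)
      have hx : x - e₁ ≠ 0 := by
        intro h0
        have := (hW.equation_iff x y).mp h'.1
        rw [h0, zero_mul, zero_mul, sq_eq_zero_iff] at this
        exact hy (by rw [hW.negY_eq, this]; simp)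
      rw [hX] at hsq
      refine ⟨(W.slope x x y y * (e₁ - x) + y) / (x - e₁), ?_⟩
      field_simp
      linear_combination hsq

end Point

namespace IsSplit

variable {W : Affine ℚ} {e₁ e₂ e₃ : ℚ} (hW : W.IsSplit e₁ e₂ e₃)

/-- The homomorphism from the Mordell-Weil group to `ℤ/2` given by the parity of the `p`-adic
valuation of the `2`-descent map attached to the root `e₁`. -/
noncomputable def descentHom (p : ℕ) [Fact p.Prime] : W.Point →+ ZMod 2 where
  toFun P := (padicValRat p (P.descentValue e₁ e₂ e₃) : ZMod 2)
  map_zero' := by simp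
  map_add' P Q := by
    obtain ⟨s, hs⟩ := Point.isSquare_descentValue_add hW P Q
    have hP := Point.descentValue_ne_zero hW P
    have hQ := Point.descentValue_ne_zero hW Q
    have hPQ := Point.descentValue_ne_zero hW (P + Q)
    have hs0 : s ≠ 0 := by
      rintro rfl
      exact mul_ne_zero (mul_ne_zero hPQ hP) hQ (by simpa using hs)
    have h := congrArg (fun q ↦ (padicValRat p q : ZMod 2)) hs
    simp only [padicValRat.mul (mul_ne_zero hPQ hP) hQ, padicValRat.mul hPQ hP,
      padicValRat.mul hs0 hs0, Int.cast_add, CharTwo.add_self_eq_zero] at h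
    rw [← CharTwo.sub_eq_add, sub_eq_zero] at h
    have := CharTwo.add_self_eq_zero (padicValRat p (P.descentValue e₁ e₂ e₃) : ZMod 2)
    linear_combination h - this

lemma descentHom_apply (p : ℕ) [Fact p.Prime] (P : W.Point) :
    hW.descentHom p P = (padicValRat p (P.descentValue e₁ e₂ e₃) : ZMod 2) := rfl

end IsSplit

end WeierstrassCurve.Affine

end

/-! ### A curve with five independent points. -/

section

open WeierstrassCurve WeierstrassCurve.Affine

lemma padicValRat_intCast_eq {p : ℕ} [Fact p.Prime] (k : ℕ) {n : ℤ} (h : (p : ℤ) ^ k ∣ n)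
    (h' : ¬(p : ℤ) ^ (k + 1) ∣ n) : padicValRat p (n : ℚ) = k := by
  obtain ⟨m, rfl⟩ := h
  have hm : ¬(p : ℤ) ∣ m := fun hd ↦ h' (by rw [pow_succ]; exact mul_dvd_mul_left _ hd)
  have hm0 : (m : ℚ) ≠ 0 := by rintro h; exact hm (by simp [Int.cast_eq_zero.mp h])
  have hp0 : (p : ℚ) ≠ 0 := by exact_mod_cast (Fact.out : p.Prime).ne_zero
  push_cast
  rw [padicValRat.mul (pow_ne_zero _ hp0) hm0, padicValRat.pow,
    padicValRat.self (Fact.out : p.Prime).one_lt, padicValRat.of_int,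
    padicValInt.eq_zero_of_not_dvd hm]
  simp

/-- The curve `y² = x (x + 3654) (x + 4711)`, whose Mordell-Weil rank is at least `5`. -/
def rankFiveCurve : Affine ℚ := ⟨0, 8365, 0, 17213994, 0⟩

namespace rankFiveCurve

lemma isSplit : rankFiveCurve.IsSplit 0 (-3654) (-4711) := by
  constructor <;> norm_num [rankFiveCurve]

instance : rankFiveCurve.IsElliptic where
  isUnit := by
    rw [isUnit_iff_ne_zero]
    norm_num [rankFiveCurve, Δ, b₂, b₄, b₆, b₈]

/-- Five independent points on `rankFiveCurve`. -/
noncomputable def basePoint : Fin 5 → rankFiveCurve.Point :=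
  ![.some (-4107) 33522 (isSplit.nonsingular_of_ne (by norm_num) (by norm_num)),
    .some (-3703) 13524 (isSplit.nonsingular_of_ne (by norm_num) (by norm_num)),
    .some 21 19110 (isSplit.nonsingular_of_ne (by norm_num) (by norm_num)),
    .some 392 89964 (isSplit.nonsingular_of_ne (by norm_num) (by norm_num)),
    .some 2178 295812 (isSplit.nonsingular_of_ne (by norm_num) (by norm_num))]

instance : Fact (Nat.Prime 7) := ⟨by norm_num⟩
instance : Fact (Nat.Prime 29) := ⟨by norm_num⟩
instance : Fact (Nat.Prime 151) := ⟨by norm_num⟩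
instance : Fact (Nat.Prime 673) := ⟨by norm_num⟩

/-- Seven homomorphisms to `ℤ/2` that separate the base points and the `2`-torsion. -/
noncomputable def parity : Fin 7 → rankFiveCurve.Point →+ ZMod 2 :=
  ![isSplit.descentHom 2, isSplit.descentHom 3, isSplit.descentHom 7, isSplit.descentHom 29,
    isSplit.descentHom 673, isSplit.rotate.descentHom 7, isSplit.rotate.descentHom 151]

lemma descentHom_some {W : Affine ℚ} {e₁ e₂ e₃ x y : ℚ} (hW : W.IsSplit e₁ e₂ e₃) {p : ℕ}
    [Fact p.Prime] (k : ℕ) (n : ℤ) (h : W.Nonsingular x y)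
    (hx : (if x = e₁ then (e₁ - e₂) * (e₁ - e₃) else x - e₁) = n) (h₁ : (p : ℤ) ^ k ∣ n)
    (h₂ : ¬(p : ℤ) ^ (k + 1) ∣ n) : hW.descentHom p (.some x y h) = k := by
  rw [hW.descentHom_apply, Point.descentValue_some, hx, padicValRat_intCast_eq k h₁ h₂,
    Int.cast_natCast]

/-- The values of `parity` at the base points. -/
abbrev basePointParity : Fin 7 → Fin 5 → ZMod 2 :=
  ![![0, 0, 0, 1, 1], ![1, 0, 1, 0, 0], ![0, 1, 1, 0, 0],
    ![0, 0, 0, 0, 0], ![0, 0, 0, 0, 0], ![0, 0, 0, 1, 0], ![1, 0, 0, 0, 0]]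

lemma parity_basePoint (j : Fin 7) (i : Fin 5) :
    parity j (basePoint i) = basePointParity j i := by
  fin_cases j <;> fin_cases i
  · exact descentHom_some isSplit 0 (-4107) _ (by norm_num) (by norm_num) (by norm_num)
  · exact descentHom_some isSplit 0 (-3703) _ (by norm_num) (by norm_num) (by norm_num)
  · exact descentHom_some isSplit 0 (21) _ (by norm_num) (by norm_num) (by norm_num)
  · exact descentHom_some isSplit 3 (392) _ (by norm_num) (by norm_num) (by norm_num)
  · exact descentHom_some isSplit 1 (2178) _ (by norm_num) (by norm_num) (by norm_num)
  · exact descentHom_some isSplit 1 (-4107) _ (by norm_num) (by norm_num) (by norm_num)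
  · exact descentHom_some isSplit 0 (-3703) _ (by norm_num) (by norm_num) (by norm_num)
  · exact descentHom_some isSplit 1 (21) _ (by norm_num) (by norm_num) (by norm_num)
  · exact descentHom_some isSplit 0 (392) _ (by norm_num) (by norm_num) (by norm_num)
  · exact descentHom_some isSplit 2 (2178) _ (by norm_num) (by norm_num) (by norm_num)
  · exact descentHom_some isSplit 0 (-4107) _ (by norm_num) (by norm_num) (by norm_num)
  · exact descentHom_some isSplit 1 (-3703) _ (by norm_num) (by norm_num) (by norm_num)
  · exact descentHom_some isSplit 1 (21) _ (by norm_num) (by norm_num) (by norm_num)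
  · exact descentHom_some isSplit 2 (392) _ (by norm_num) (by norm_num) (by norm_num)
  · exact descentHom_some isSplit 0 (2178) _ (by norm_num) (by norm_num) (by norm_num)
  · exact descentHom_some isSplit 0 (-4107) _ (by norm_num) (by norm_num) (by norm_num)
  · exact descentHom_some isSplit 0 (-3703) _ (by norm_num) (by norm_num) (by norm_num)
  · exact descentHom_some isSplit 0 (21) _ (by norm_num) (by norm_num) (by norm_num)
  · exact descentHom_some isSplit 0 (392) _ (by norm_num) (by norm_num) (by norm_num)
  · exact descentHom_some isSplit 0 (2178) _ (by norm_num) (by norm_num) (by norm_num)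
  · exact descentHom_some isSplit 0 (-4107) _ (by norm_num) (by norm_num) (by norm_num)
  · exact descentHom_some isSplit 0 (-3703) _ (by norm_num) (by norm_num) (by norm_num)
  · exact descentHom_some isSplit 0 (21) _ (by norm_num) (by norm_num) (by norm_num)
  · exact descentHom_some isSplit 0 (392) _ (by norm_num) (by norm_num) (by norm_num)
  · exact descentHom_some isSplit 0 (2178) _ (by norm_num) (by norm_num) (by norm_num)
  · exact descentHom_some isSplit.rotate 0 (-453) _ (by norm_num) (by norm_num) (by norm_num)
  · exact descentHom_some isSplit.rotate 2 (-49) _ (by norm_num) (by norm_num) (by norm_num)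
  · exact descentHom_some isSplit.rotate 2 (3675) _ (by norm_num) (by norm_num) (by norm_num)
  · exact descentHom_some isSplit.rotate 1 (4046) _ (by norm_num) (by norm_num) (by norm_num)
  · exact descentHom_some isSplit.rotate 0 (5832) _ (by norm_num) (by norm_num) (by norm_num)
  · exact descentHom_some isSplit.rotate 1 (-453) _ (by norm_num) (by norm_num) (by norm_num)
  · exact descentHom_some isSplit.rotate 0 (-49) _ (by norm_num) (by norm_num) (by norm_num)
  · exact descentHom_some isSplit.rotate 0 (3675) _ (by norm_num) (by norm_num) (by norm_num)
  · exact descentHom_some isSplit.rotate 0 (4046) _ (by norm_num) (by norm_num) (by norm_num)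
  · exact descentHom_some isSplit.rotate 0 (5832) _ (by norm_num) (by norm_num) (by norm_num)

lemma parity_root_zero (j : Fin 7) :
    parity j (.some 0 0 isSplit.nonsingular_root) =
      (![1, 0, 0, 1, 1, 1, 0] : Fin 7 → ZMod 2) j := by
  fin_cases j
  · exact descentHom_some isSplit 1 (17213994) _ (by norm_num) (by norm_num) (by norm_num)
  · exact descentHom_some isSplit 2 (17213994) _ (by norm_num) (by norm_num) (by norm_num)
  · exact descentHom_some isSplit 2 (17213994) _ (by norm_num) (by norm_num) (by norm_num)
  · exact descentHom_some isSplit 1 (17213994) _ (by norm_num) (by norm_num) (by norm_num)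
  · exact descentHom_some isSplit 1 (17213994) _ (by norm_num) (by norm_num) (by norm_num)
  · exact descentHom_some isSplit.rotate 1 (3654) _ (by norm_num) (by norm_num) (by norm_num)
  · exact descentHom_some isSplit.rotate 0 (3654) _ (by norm_num) (by norm_num) (by norm_num)

lemma parity_root_neg_3654 (j : Fin 7) :
    parity j (.some (-3654) 0 isSplit.rotate.nonsingular_root) =
      (![1, 0, 1, 1, 0, 0, 1] : Fin 7 → ZMod 2) j := by
  fin_cases j
  · exact descentHom_some isSplit 1 (-3654) _ (by norm_num) (by norm_num) (by norm_num)
  · exact descentHom_some isSplit 2 (-3654) _ (by norm_num) (by norm_num) (by norm_num)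
  · exact descentHom_some isSplit 1 (-3654) _ (by norm_num) (by norm_num) (by norm_num)
  · exact descentHom_some isSplit 1 (-3654) _ (by norm_num) (by norm_num) (by norm_num)
  · exact descentHom_some isSplit 0 (-3654) _ (by norm_num) (by norm_num) (by norm_num)
  · exact descentHom_some isSplit.rotate 2 (-3862278) _ (by norm_num) (by norm_num) (by norm_num)
  · exact descentHom_some isSplit.rotate 1 (-3862278) _ (by norm_num) (by norm_num) (by norm_num)

lemma parity_root_neg_4711 (j : Fin 7) :
    parity j (.some (-4711) 0 isSplit.rotate.rotate.nonsingular_root) =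
      (![0, 0, 1, 0, 1, 1, 1] : Fin 7 → ZMod 2) j := by
  fin_cases j
  · exact descentHom_some isSplit 0 (-4711) _ (by norm_num) (by norm_num) (by norm_num)
  · exact descentHom_some isSplit 0 (-4711) _ (by norm_num) (by norm_num) (by norm_num)
  · exact descentHom_some isSplit 1 (-4711) _ (by norm_num) (by norm_num) (by norm_num)
  · exact descentHom_some isSplit 0 (-4711) _ (by norm_num) (by norm_num) (by norm_num)
  · exact descentHom_some isSplit 1 (-4711) _ (by norm_num) (by norm_num) (by norm_num)
  · exact descentHom_some isSplit.rotate 1 (-1057) _ (by norm_num) (by norm_num) (by norm_num)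
  · exact descentHom_some isSplit.rotate 1 (-1057) _ (by norm_num) (by norm_num) (by norm_num)

/-- The sum is 2-torsion. The parity vectors of the base points are independent modulo 2, and their
span contains no parity vector of a nontrivial 2-torsion point. -/
lemma even_and_eq_zero_of_add_self_eq_zero {m : Fin 5 → ℤ}
    (h : ∑ i, m i • basePoint i + ∑ i, m i • basePoint i = 0) :
    (∀ i, (2 : ℤ) ∣ m i) ∧ ∑ i, m i • basePoint i = 0 := by
  have key (j : Fin 7) : parity j (∑ i, m i • basePoint i) = ∑ i, (m i : ZMod 2) *
basePointParity j i := by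
    simp only [map_sum, map_zsmul, parity_basePoint, zsmul_eq_mul]
  have hdvd (h : ∀ i, (m i : ZMod 2) = 0) (i : Fin 5) : (2 : ℤ) ∣ m i :=
    (ZMod.intCast_zmod_eq_zero_iff_dvd (m i) 2).mp (h i)
  -- Only the residues of m modulo 2 matter, which leaves a finite check over (ℤ/2)⁵.
  generalize hc : (fun i ↦ (m i : ZMod 2)) = c at *
  have hc' (i : Fin 5) : (m i : ZMod 2) = c i := congrFun hc i
  simp only [hc'] at key hdvd
  rcases Point.eq_zero_or_eq_root_of_add_self_eq_zero isSplit h with h | h | h | h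
  · refine ⟨hdvd ?_, h⟩
    simp only [h, map_zero] at key
    clear hdvd hc' hc h
    revert c
    decide
  all_goals
    exfalso
    simp only [h, parity_root_zero, parity_root_neg_3654, parity_root_neg_4711] at key
    clear hdvd hc' hc h
    revert c
    decide

/-- The base points are linearly independent over `ℤ`. -/
lemma eq_zero_of_sum_zsmul_eq_zero {m : Fin 5 → ℤ} (h : ∑ i, m i • basePoint i = 0) : m = 0 := by
  -- Infinite descent: a relation m is 2m', and the m'-combination, being killed by 2, is again zero
  -- by the previous lemma.
  have hpow (k : ℕ) : ∀ m : Fin 5 → ℤ, ∑ i, m i • basePoint i = 0 → ∀ i, (2 : ℤ) ^ k ∣ m i := by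
    induction k with
    | zero => simp
    | succ k ih =>
      intro m h i
      choose m' hm' using (even_and_eq_zero_of_add_self_eq_zero (by rw [h, add_zero])).1
      have h' : ∑ i, m' i • basePoint i + ∑ i, m' i • basePoint i = 0 := by
        rw [← Finset.sum_add_distrib, ← h]
        exact Finset.sum_congr rfl fun i _ ↦ by rw [hm', two_mul, add_zsmul]
      rw [hm', pow_succ']
      exact mul_dvd_mul_left _ (ih m' (even_and_eq_zero_of_add_self_eq_zero h').2 i)
  ext i
  refine Int.eq_zero_of_abs_lt_dvd (hpow (m i).natAbs m h i) ?_
  rw [Int.abs_eq_natAbs]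
  exact_mod_cast Nat.lt_two_pow_self

end rankFiveCurve

end

/-! ### From points on the curve to translates consisting of squares. -/

section

open WeierstrassCurve WeierstrassCurve.Affine Height

namespace rankFiveCurve

/-- Abscissas determine points only up to sign; positive coefficients exclude the minus sign. The
case m' = 0 shows that the doubled sums are nonzero. -/
lemma eq_of_two_nsmul_eq_or_eq_neg {m m' : Fin 5 → ℕ} (hm : ∀ i, 1 ≤ m i)
    (h : (2 • ∑ i, m i • basePoint i : rankFiveCurve.Point) = 2 • ∑ i, m' i • basePoint i ∨
      (2 • ∑ i, m i • basePoint i : rankFiveCurve.Point) = -(2 • ∑ i, m' i • basePoint i)) :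
    m = m' := by
  rcases h with h | h
  · have h0 : ∑ i, (2 * ((m i : ℤ) - m' i)) • basePoint i = 0 := by
      rw [← sub_eq_zero] at h
      refine Eq.trans ?_ h
      rw [← nsmul_sub, ← Finset.sum_sub_distrib, Finset.smul_sum]
      refine Finset.sum_congr rfl fun i _ ↦ ?_
      rw [mul_zsmul, sub_zsmul, natCast_zsmul, natCast_zsmul, two_zsmul, two_nsmul, sub_eq_add_neg]
    ext i
    have := congrFun (eq_zero_of_sum_zsmul_eq_zero h0) i
    simp only [Pi.zero_apply] at this
    lia
  · have h0 : ∑ i, (2 * ((m i : ℤ) + m' i)) • basePoint i = 0 := by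
      rw [eq_neg_iff_add_eq_zero] at h
      refine Eq.trans ?_ h
      rw [← nsmul_add, ← Finset.sum_add_distrib, Finset.smul_sum]
      refine Finset.sum_congr rfl fun i _ ↦ ?_
      rw [mul_zsmul, add_zsmul, natCast_zsmul, natCast_zsmul, two_zsmul, two_nsmul]
    have := congrFun (eq_zero_of_sum_zsmul_eq_zero h0) 0
    simp only [Pi.zero_apply] at this
    have := hm 0
    lia

lemma exists_finset_isSquare_sub : ∃ C : ℝ, 0 ≤ C ∧ ∀ M : ℕ, 1 ≤ M → ∃ X : Finset ℚ,
    X.card = M ^ 5 ∧ ∀ r ∈ X, logHeight₁ r ≤ C * M ^ 2 ∧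
      IsSquare r ∧ IsSquare (r + 3654) ∧ IsSquare (r + 4711) := by
  obtain ⟨C, hC, hh⟩ := Point.exists_naiveHeight_sum_nsmul_le basePoint
  -- Doubling puts the coefficients in 2, …, 2M, whence 4 = 2².
  refine ⟨C * 4, by positivity, fun M hM ↦ ?_⟩
  let Q (m : Fin 5 → ℕ) : rankFiveCurve.Point := 2 • (∑ i, m i • basePoint i)
  have hne {m : Fin 5 → ℕ} (hm : ∀ i, 1 ≤ m i) : Q m ≠ 0 := fun h0 ↦ by
    have := congrFun (eq_of_two_nsmul_eq_or_eq_neg (m' := 0) hm (.inl (by simpa [Q] using h0))) 0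
    have := hm 0
    simp_all
  let S : Finset (Fin 5 → ℕ) := Fintype.piFinset fun _ ↦ Finset.Icc 1 M
  have hS {m : Fin 5 → ℕ} (hm : m ∈ S) (i : Fin 5) : 1 ≤ m i ∧ m i ≤ M :=
    Finset.mem_Icc.mp (Fintype.mem_piFinset.mp hm i)
  have hx (m : Fin 5 → ℕ) (hm : m ∈ S) : ∃ x y, ∃ h : rankFiveCurve.Nonsingular x y,
      Q m = .some x y h := by
    cases hQ : Q m with
    | zero => exact absurd hQ (hne fun i ↦ (hS hm i).1)
    | some x y h => exact ⟨x, y, h, rfl⟩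
  let f (m : Fin 5 → ℕ) : ℚ := (Q m).xRep 0
  have hf (m : Fin 5 → ℕ) (hm : m ∈ S) : ∃ y, ∃ h : rankFiveCurve.Nonsingular (f m) y,
      Q m = .some (f m) y h := by
    obtain ⟨x, y, h, hQ⟩ := hx m hm
    have : f m = x := by simp only [f, hQ]; rfl
    exact this ▸ ⟨y, h, hQ⟩
  refine ⟨S.image f, ?_, ?_⟩
  · rw [Finset.card_image_of_injOn]
    · simp [S]
    · intro m hm m' hm' hmm
      obtain ⟨y, h, hQ⟩ := hf m hm
      obtain ⟨y', h', hQ'⟩ := hf m' hm'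
      refine eq_of_two_nsmul_eq_or_eq_neg (fun i ↦ (hS hm i).1) ?_
      have := Point.X_eq_iff (h₁ := h) (h₂ := h').mp hmm
      rwa [← hQ, ← hQ'] at this
  · intro r hr
    obtain ⟨m, hm, rfl⟩ := Finset.mem_image.mp hr
    obtain ⟨y, h, hQ⟩ := hf m hm
    have hQ2 : ∑ i, m i • basePoint i + ∑ i, m i • basePoint i = .some (f m) y h := by
      rw [← two_nsmul]; exact hQ
    refine ⟨?_, ?_, ?_, ?_⟩
    · rw [← Point.naiveHeight_some h, ← hQ]
      have := hh (2 * M) (fun i ↦ 2 * m i) (by lia) (fun i ↦ by have := (hS hm i).2; lia)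
      simp only [mul_nsmul', ← Finset.smul_sum] at this
      refine this.trans (le_of_eq ?_)
      push_cast; ring
    · simpa using Point.isSquare_X_sub_of_add_self isSplit hQ2
    · simpa using Point.isSquare_X_sub_of_add_self isSplit.rotate hQ2
    · simpa using Point.isSquare_X_sub_of_add_self isSplit.rotate.rotate hQ2

end rankFiveCurve

lemma Rat.abs_num_le_exp_logHeight₁ (r : ℚ) : |(r.num : ℝ)| ≤ Real.exp (logHeight₁ r) := by
  rw [Rat.logHeight₁_eq_log_max, Real.exp_log (by exact_mod_cast lt_max_of_lt_right r.den_pos),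
    ← Int.cast_abs, Int.abs_eq_natAbs, Int.cast_natCast]
  exact Nat.cast_le.mpr (le_max_left _ _)

lemma Rat.den_le_exp_logHeight₁ (r : ℚ) : (r.den : ℝ) ≤ Real.exp (logHeight₁ r) := by
  rw [Rat.logHeight₁_eq_log_max, Real.exp_log (by exact_mod_cast lt_max_of_lt_right r.den_pos)]
  exact_mod_cast le_max_right _ _

/-- Clearing denominators in a set of rational numbers `r` of bounded height with `r + e` a square
for all `e ∈ E` gives integers `x` with `A + x` consisting of squares, where `A` is a multiple
of `E`. -/
lemma card_le_maxSquareTranslates {X : Finset ℚ} {E : Finset ℤ} {H B : ℝ} {n : ℕ}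
    (hH : ∀ r ∈ X, logHeight₁ r ≤ H) (hX : ∀ r ∈ X, ∀ e ∈ E, IsSquare (r + e))
    (hH0 : 0 ≤ H) (hB : 1 ≤ B) (hE : ∀ e ∈ E, |(e : ℝ)| ≤ B)
    (hn : B * Real.exp (2 * H * X.card + H) ≤ n) : X.card ≤ maxSquareTranslates E.card n := by
  -- A single D must serve every r, as A may not depend on r. It satisfies log D ≤ H · |X|.
  set D : ℕ := ∏ r ∈ X, r.den with hD
  have hD0 : D ≠ 0 := Finset.prod_ne_zero_iff.mpr fun r _ ↦ r.den_ne_zero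
  have hDZ : ((D : ℤ) ^ 2) ≠ 0 := by positivity
  have hDle : (D : ℝ) ^ 2 ≤ Real.exp (2 * H * X.card) := by
    have : (D : ℝ) ≤ Real.exp H ^ X.card := by
      rw [hD, Nat.cast_prod]
      rw [← Finset.prod_const]
      refine Finset.prod_le_prod (fun _ _ ↦ Nat.cast_nonneg _) fun r hr ↦ ?_
      exact r.den_le_exp_logHeight₁.trans (Real.exp_le_exp.mpr (hH r hr))
    calc (D : ℝ) ^ 2 ≤ (Real.exp H ^ X.card) ^ 2 := by gcongr
      _ = Real.exp (2 * H * X.card) := by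
        rw [← Real.exp_nat_mul, ← Real.exp_nat_mul]; congr 1; push_cast; ring
  rw [Real.exp_add] at hn
  have hexpH := Real.one_le_exp hH0
  have mem_Icc {z : ℤ} (hz : |(z : ℝ)| ≤ n) : z ∈ Finset.Icc (-(n : ℤ)) n := by
    rw [Finset.mem_Icc, ← abs_le]
    exact_mod_cast hz
  have hint (r : ℚ) (hr : r ∈ X) : ∃ z : ℤ, (z : ℚ) = (D : ℚ) ^ 2 * r := by
    obtain ⟨k, hk⟩ := Finset.dvd_prod_of_mem Rat.den hr
    refine ⟨D * k * r.num, ?_⟩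
    have hDk : (D : ℚ) = r.den * k := by rw [hD, hk]; push_cast; rfl
    push_cast
    rw [← r.den_mul_eq_num]
    linear_combination -(D : ℚ) * r * hDk
  choose! g hg using hint
  let A : Finset ℤ := E.image fun e ↦ (D : ℤ) ^ 2 * e
  have hAcard : A.card = E.card :=
    Finset.card_image_of_injective _ (mul_right_injective₀ hDZ)
  have hA : A ∈ (Finset.Icc (-(n : ℤ)) (n : ℤ)).powersetCard E.card := by
    refine Finset.mem_powersetCard.mpr ⟨fun a ha ↦ ?_, hAcard⟩
    obtain ⟨e, he, rfl⟩ := Finset.mem_image.mp ha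
    refine mem_Icc (le_trans ?_ hn)
    push_cast
    rw [abs_mul, abs_of_nonneg (by positivity), mul_comm]
    refine mul_le_mul (hE e he) (hDle.trans ?_) (by positivity) (by positivity)
    exact le_mul_of_one_le_right (Real.exp_nonneg _) hexpH
  refine le_trans ?_ (Finset.le_sup (f := squareTranslates n) hA)
  rw [squareTranslates, ← Finset.card_image_of_injOn (s := X) (f := g)]
  · refine Finset.card_le_card fun z hz ↦ ?_
    obtain ⟨r, hr, rfl⟩ := Finset.mem_image.mp hz
    refine Finset.mem_filter.mpr ⟨mem_Icc (le_trans ?_ hn), fun a ha ↦ ?_⟩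
    · have hgr : ((g r : ℤ) : ℝ) = (D : ℝ) ^ 2 * r := by
        exact_mod_cast congrArg (Rat.cast (K := ℝ)) (hg r hr)
      have hrle : |(r : ℝ)| ≤ Real.exp H := by
        rw [Rat.cast_def, abs_div, Nat.abs_cast]
        refine (div_le_self (abs_nonneg _) (by exact_mod_cast r.den_pos)).trans ?_
        exact r.abs_num_le_exp_logHeight₁.trans (Real.exp_le_exp.mpr (hH r hr))
      rw [hgr, abs_mul, abs_of_nonneg (by positivity)]
      exact (mul_le_mul hDle hrle (abs_nonneg _) (Real.exp_nonneg _)).trans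
        (le_mul_of_one_le_left (by positivity) hB)
    · obtain ⟨e, he, rfl⟩ := Finset.mem_image.mp ha
      rw [← Rat.isSquare_intCast_iff]
      obtain ⟨s, hs⟩ := hX r hr e he
      refine ⟨D * s, ?_⟩
      push_cast
      rw [hg r hr]
      linear_combination (D : ℚ) ^ 2 * hs
  · intro r hr r' hr' h
    have hDQ : (D : ℚ) ^ 2 ≠ 0 := by positivity
    have h1 := hg r hr
    rw [h, hg r' hr'] at h1
    exact (mul_right_injective₀ hDQ h1).symm

lemma exists_pow_five_le_maxSquareTranslates : ∃ K : ℝ, 0 < K ∧ ∀ M n : ℕ, 1 ≤ M →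
    Real.exp (K * M ^ 7) ≤ n → M ^ 5 ≤ maxSquareTranslates 3 n := by
  obtain ⟨C, hC, h⟩ := rankFiveCurve.exists_finset_isSquare_sub
  -- 2C comes from D², C from the size of r, and 4711 from bounding the shifts by exp 4711.
  refine ⟨3 * C + 4711, by positivity, fun M n hM hn ↦ ?_⟩
  obtain ⟨X, hcard, hX⟩ := h M hM
  have hM' : (1 : ℝ) ≤ M := by exact_mod_cast hM
  have hE : ({0, 3654, 4711} : Finset ℤ).card = 3 := rfl
  rw [← hcard, ← hE]
  refine card_le_maxSquareTranslates (H := C * M ^ 2) (B := 4711) (fun r hr ↦ (hX r hr).1) ?_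
    (by positivity) (by norm_num) (by simp; norm_num) (le_trans ?_ hn)
  · intro r hr e he
    obtain ⟨-, h1, h2, h3⟩ := hX r hr
    simp only [Finset.mem_insert, Finset.mem_singleton] at he
    rcases he with rfl | rfl | rfl
    · simpa using h1
    · exact_mod_cast h2
    · exact_mod_cast h3
  · have h1 : (4711 : ℝ) ≤ Real.exp 4711 := by linarith [Real.add_one_le_exp (4711 : ℝ)]
    refine (mul_le_mul_of_nonneg_right h1 (Real.exp_nonneg _)).trans ?_
    rw [← Real.exp_add, Real.exp_le_exp, hcard]
    push_cast
    have h7 : (1 : ℝ) ≤ (M : ℝ) ^ 7 := one_le_pow₀ hM'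
    have h27 : (M : ℝ) ^ 2 ≤ (M : ℝ) ^ 7 := pow_le_pow_right₀ hM' (by norm_num)
    have := mul_le_mul_of_nonneg_left h27 hC
    calc (4711 : ℝ) + (2 * (C * M ^ 2) * M ^ 5 + C * M ^ 2)
        = 4711 * 1 + 2 * (C * M ^ 7) + C * M ^ 2 := by ring
      _ ≤ 4711 * M ^ 7 + 2 * (C * M ^ 7) + C * M ^ 7 := by gcongr
      _ = (3 * C + 4711) * M ^ 7 := by ring

end

theorem mainTheorem8 :
    ∃ c : ℝ, 0 < c ∧ ∀ᶠ n : ℕ in Filter.atTop,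
      c * Real.log (n : ℝ) ^ ((5 : ℝ) / 7) ≤ (maxSquareTranslates 3 n : ℝ) := by
  obtain ⟨K, hK, h⟩ := exists_pow_five_le_maxSquareTranslates
  -- Take M = ⌊t⌋ with K t⁷ = log n. Since t ≥ 1, M ≥ t/2, and 32 = 2⁵ pays for the rounding.
  refine ⟨(K ^ ((5 : ℝ) / 7))⁻¹ / 32, by positivity, ?_⟩
  have hlog : Filter.Tendsto (fun n : ℕ ↦ Real.log n) .atTop .atTop :=
    Real.tendsto_log_atTop.comp tendsto_natCast_atTop_atTop
  filter_upwards [hlog.eventually_ge_atTop K, Filter.eventually_gt_atTop 0] with n hn hn0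
  have hn0' : (0 : ℝ) < n := by exact_mod_cast hn0
  set L := Real.log n
  have hLK : 1 ≤ L / K := (one_le_div hK).mpr hn
  set t : ℝ := (L / K) ^ ((1 : ℝ) / 7) with ht
  have ht1 : 1 ≤ t := Real.one_le_rpow hLK (by norm_num)
  have ht7 : t ^ 7 = L / K := by
    rw [ht, ← Real.rpow_natCast, ← Real.rpow_mul (by positivity)]; norm_num
  have ht5 : t ^ 5 = (K ^ ((5 : ℝ) / 7))⁻¹ * L ^ ((5 : ℝ) / 7) := by
    rw [ht, ← Real.rpow_natCast, ← Real.rpow_mul (by positivity), Real.div_rpow (by linarith) hK.le]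
    norm_num
    ring
  have hM1 : 1 ≤ ⌊t⌋₊ := Nat.one_le_floor_iff _ |>.mpr ht1
  have hMt : (⌊t⌋₊ : ℝ) ≤ t := Nat.floor_le (by linarith)
  have hM1' : (1 : ℝ) ≤ ⌊t⌋₊ := by exact_mod_cast hM1
  have hMt' : t / 2 ≤ ⌊t⌋₊ := by linarith [Nat.lt_floor_add_one t]
  have hle := h ⌊t⌋₊ n hM1 (by
    rw [← Real.le_log_iff_exp_le hn0']
    calc K * (⌊t⌋₊ : ℝ) ^ 7 ≤ K * t ^ 7 := by gcongr
      _ = L := by rw [ht7]; field_simp)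
  calc (K ^ ((5 : ℝ) / 7))⁻¹ / 32 * L ^ ((5 : ℝ) / 7) = (t / 2) ^ 5 := by rw [div_pow, ht5]; ring
    _ ≤ (⌊t⌋₊ : ℝ) ^ 5 := by gcongr
    _ ≤ _ := by exact_mod_cast hle
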